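/- Let $\mathbb H=\{z\in\mathbb C:\operatorname{Re}z>0\}$, let $\overline{\mathbb C}=\mathbb C\cup\{\infty\}$ be the Riemann sphere, and for a holomorphic, locally injective function $f$ let $Sf=(f''/f')'-\frac12(f''/f')^2$ be its Schwarzian derivative. A Jordan domain is a domain in $\overline{\mathbb C}$ whose boundary in $\overline{\mathbb C}$ is a Jordan curve; a quasidisk is the image of a half-plane (equivalently, of a disk) under a quasiconformal homeomorphism of $\overline{\mathbb C}$ onto itself. There is a conformal (that is, holomorphic and injective) map $f$ on $\mathbb H$, with $f(z)\to\infty$ as $z\to\infty$ in $\mathbb H$, such that (i) the image $f(\mathbb H)$ is a Jordan domain in $\overline{\mathbb C}$ but not a quasidisk; and (ii) $\displaystyle\lim_{\operatorname{Re}z\to0^+}(2\operatorname{Re}z)^2\,|Sf(z)|=0$, that is, $(2\operatorname{Re}z)^2|Sf(z)|\to0$ as $\operatorname{Re}z\to0^+$, uniformly in $\operatorname{Im}z$. Explicitly, $f(z)=-i\arcsin\!\big(\tfrac{i(z+1)}{2}\big)$ has these properties, where $\arcsin w=-i\operatorname{Log}\big(iw+\sqrt{1-w^2}\big)$ is the principal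 branch. -/

import Mathlib

open Set Filter Topology MeasureTheory
open scoped ENNReal NNReal

noncomputable section

namespace HalfPlaneExample

/-- The right half-plane `{z : 0 < Re z}`. -/
def rightHalfPlane : Set ℂ := {z : ℂ | 0 < z.re}

/-- A conformal map on `U`: holomorphic and injective on `U`. -/
def IsConformalMapOn (f : ℂ → ℂ) (U : Set ℂ) : Prop :=
  DifferentiableOn ℂ f U ∧ InjOn f U

/-- The pre-Schwarzian derivative `P f = f'' / f'`. -/
def preSchwarzian (f : ℂ → ℂ) (z : ℂ) : ℂ := deriv (deriv f) z / deriv f z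

/-- The Schwarzian derivative `S f = (P f)' - (P f)² / 2`. -/
def schwarzian (f : ℂ → ℂ) (z : ℂ) : ℂ :=
  deriv (preSchwarzian f) z - preSchwarzian f z ^ 2 / 2

/-- The principal branch of the arcsine, `arcsin w = -i Log (i w + √(1 - w²))`, with the principal
logarithm and the principal square root. -/
def arcsin (w : ℂ) : ℂ :=
  -Complex.I * Complex.log (Complex.I * w + (1 - w ^ 2) ^ (1 / 2 : ℂ))

/-- The Riemann sphere, the one-point compactification of `ℂ`. -/
abbrev Sphere : Type := OnePoint ℂ

/-- A subset of `ℂ` viewed as a subset of the Riemann sphere. -/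
def toSphere (s : Set ℂ) : Set Sphere := (fun z : ℂ => (z : Sphere)) '' s

/-- A Jordan curve in the Riemann sphere: the image of the circle under a continuous injection. -/
def IsJordanCurve (J : Set Sphere) : Prop :=
  ∃ γ : Circle → Sphere, Continuous γ ∧ Function.Injective γ ∧ range γ = J

/-- A Jordan domain in the Riemann sphere: a domain whose boundary in the sphere is a Jordan
curve. -/
def IsJordanDomain (D : Set Sphere) : Prop :=
  IsOpen D ∧ IsConnected D ∧ IsJordanCurve (frontier D)

/-- A (compact) path in the plane, parametrized by the unit interval. -/
abbrev PlanePath : Type := C(unitInterval, ℂ)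

/-- The length of a path. -/
def pathLength (c : PlanePath) : ℝ≥0∞ := eVariationOn c univ

/-- The line integral `∫_c ρ ds` along a rectifiable path, computed in its arc length
parametrization on `[0, length c]`. -/
def lineIntegral (ρ : ℂ → ℝ≥0∞) (c : PlanePath) : ℝ≥0∞ :=
  ∫⁻ s in Icc 0 (pathLength c).toReal, ρ (naturalParameterization c univ 0 s)

/-- `ρ` is admissible for a path family: it is a nonnegative Borel function whose integral along
every rectifiable path of the family is at least `1`. -/
def IsAdmissible (ρ : ℂ → ℝ≥0∞) (Γ : Set PlanePath) : Prop :=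
  Measurable ρ ∧ ∀ c ∈ Γ, pathLength c ≠ ⊤ → 1 ≤ lineIntegral ρ c

/-- The (conformal) modulus of a path family, the infimum of `∫ ρ²` over admissible `ρ`. -/
def modulus (Γ : Set PlanePath) : ℝ≥0∞ :=
  ⨅ (ρ : ℂ → ℝ≥0∞) (_ : IsAdmissible ρ Γ), ∫⁻ z : ℂ, ρ z ^ 2

/-- The image of a family of plane paths under a map of the sphere (meant for families whose image
paths avoid `∞`). -/
def imageFamily (F : Sphere → Sphere) (Γ : Set PlanePath) : Set PlanePath :=
  {d | ∃ c ∈ Γ, ∀ t, (d t : Sphere) = F (c t)}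

/-- Quasiconformal homeomorphisms of the Riemann sphere, by the geometric definition: for some
`K ≥ 1`, the modulus of path families is distorted at most by the factor `K` in both directions.
The families range over all families of paths which avoid `∞` and whose images avoid `∞`; the
points `∞` and `F⁻¹(∞)` are removable. The map may preserve or reverse the orientation. -/
def IsQuasiconformal (F : Sphere ≃ₜ Sphere) : Prop :=
  ∃ K : ℝ≥0, 1 ≤ K ∧ ∀ Γ : Set PlanePath,
    (∀ c ∈ Γ, ∀ t, F (c t) ≠ OnePoint.infty) →
      modulus (imageFamily F Γ) ≤ K * modulus Γ ∧ modulus Γ ≤ K * modulus (imageFamily F Γ)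

/-- A quasidisk: the image of a half-plane under a quasiconformal homeomorphism of the Riemann
sphere. All discs and half-planes of the sphere are equivalent under Möbius transformations, and
half-planes are symmetric under a reflection, so neither the choice of the half-plane nor
the orientation of the homeomorphism matters. -/
def IsQuasidisk (D : Set Sphere) : Prop :=
  ∃ F : Sphere ≃ₜ Sphere, IsQuasiconformal F ∧ F '' toSphere rightHalfPlane = D

end HalfPlaneExample

end

/-! The map is `f(z) = arsinh((z + 1) / 2)`, the inverse of `w ↦ 2 sinh w - 1` on the strip `|Im w|
< π / 2`. Its singularities `-1 ± 2i` lie at distance `1` from the half-plane, so the Schwarzian is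
bounded there (`norm_schwarzian_halfStripMap_le`) and the factor `(2 Re z)²` forces the limit. The
image `sinh x cos y > 1 / 2` is asymptotically a half-strip of width `π`. Its boundary is the
injective image of the imaginary axis, closed up by `∞` (`isJordanDomain_halfStrip`).

At `∞` this domain has a cusp, which no quasidisk has. Suppose a `K`-quasiconformal `F` maps the
half-plane onto it. The vertical cross-cuts over `[R, 2R]` have bounded length, so their modulus is
at least `R / 4` (`le_modulus_verticalSegment`). Pull them back by `F`, reflect in the imaginary
axis and map forward again. The new paths keep their endpoints but avoid the domain, so they must go
round its tip and have size comparable to `R`; their modulus is at most `49π`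
(`modulus_le_of_dist`). Reflection preserves modulus, hence `R / 4 ≤ 49π K²` for all large `R`,
which is absurd. -/

namespace HalfPlaneExample

/-! ### Arc length and line integrals along rectifiable paths -/

section PathLength

variable {c : PlanePath}

/-- Variation sees only mutual distances. This lets a segment be replaced by a monotone real
function, and a path by its isometric image. -/
theorem eVariationOn_congr_edist {α E F : Type*} [LinearOrder α] [PseudoEMetricSpace E]
    [PseudoEMetricSpace F] {f : α → E} {g : α → F}
    (h : ∀ x y, edist (f x) (f y) = edist (g x) (g y)) (s : Set α) :
    eVariationOn f s = eVariationOn g s := by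
  simp only [eVariationOn, h]

theorem variationOnFromTo_congr_edist {α E F : Type*} [LinearOrder α] [PseudoEMetricSpace E]
    [PseudoEMetricSpace F] {f : α → E} {g : α → F}
    (h : ∀ x y, edist (f x) (f y) = edist (g x) (g y)) (s : Set α) (a : α) :
    variationOnFromTo f s a = variationOnFromTo g s a := by
  ext b
  simp only [variationOnFromTo, eVariationOn_congr_edist h]

theorem boundedVariationOn_of_pathLength_ne_top (hc : pathLength c ≠ ⊤) :
    BoundedVariationOn c univ := hc

theorem variationOnFromTo_zero_one :
    variationOnFromTo c univ 0 1 = (pathLength c).toReal := by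
  rw [variationOnFromTo.eq_of_le _ _ zero_le_one, pathLength]
  congr 2
  ext t
  simp [unitInterval.le_one']

/-- For a continuous path of bounded variation, the variation over a one-sided interval shrinking to
a point tends to `0`; additivity of the variation carries this to the arc length function. -/
theorem continuous_variationOnFromTo (hc : pathLength c ≠ ⊤) :
    Continuous (variationOnFromTo c univ 0) := by
  have hb := boundedVariationOn_of_pathLength_ne_top hc
  rw [continuous_iff_continuousAt]
  intro x
  have hl := hb.tendsto_eVariationOn_Icc_zero_left (x := x) c.continuous.continuousWithinAt
  have hr := hb.tendsto_eVariationOn_Icc_zero_right x c.continuous.continuousWithinAt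
  rw [nhdsWithin_univ] at hl hr
  have hl' := (ENNReal.tendsto_toReal ENNReal.zero_ne_top).comp hl
  have hr' := (ENNReal.tendsto_toReal ENNReal.zero_ne_top).comp hr
  have hs : Tendsto (fun y => variationOnFromTo c univ x y) (𝓝 x) (𝓝 0) := by
    rw [tendsto_zero_iff_abs_tendsto_zero]
    refine squeeze_zero (fun y => abs_nonneg _) (fun y => ?_)
      (by simpa using hl'.add hr')
    rcases le_total x y with h | h
    · rw [Function.comp_apply, variationOnFromTo.eq_of_le _ _ h, abs_of_nonneg ENNReal.toReal_nonneg]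
      simp
    · rw [Function.comp_apply, variationOnFromTo.eq_of_ge _ _ h, abs_neg,
        abs_of_nonneg ENNReal.toReal_nonneg]
      simp
  have key : ∀ y, variationOnFromTo c univ 0 y =
      variationOnFromTo c univ 0 x + variationOnFromTo c univ x y := fun y =>
    (variationOnFromTo.add hb.locallyBoundedVariationOn (mem_univ _) (mem_univ _)
      (mem_univ _)).symm
  unfold ContinuousAt
  rw [funext key]
  simp only [variationOnFromTo.self]
  exact hs.const_add (variationOnFromTo c univ 0 x)

/-- Arc length parameters are attained along a rectifiable path. -/
theorem exists_naturalParameterization_eq (hc : pathLength c ≠ ⊤) {s : ℝ}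
    (hs : s ∈ Icc 0 (pathLength c).toReal) :
    ∃ t, variationOnFromTo c univ 0 t = s ∧ naturalParameterization c univ 0 s = c t := by
  have hex : ∃ t ∈ (univ : Set unitInterval), variationOnFromTo c univ 0 t = s := by
    obtain ⟨t, ht⟩ := mem_range_of_exists_le_of_exists_ge (continuous_variationOnFromTo hc)
      ⟨0, (variationOnFromTo.self _ _ _).le.trans hs.1⟩
      ⟨1, hs.2.trans variationOnFromTo_zero_one.ge⟩
    exact ⟨t, mem_univ _, ht⟩
  -- The witness is the parameter selected by `invFunOn`, not the one from the intermediate value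
  -- theorem; this makes the second equation definitional.
  exact ⟨_, (Function.invFunOn_pos hex).2, rfl⟩

theorem dist_le_variationOnFromTo (hc : pathLength c ≠ ⊤) (t : unitInterval) :
    dist (c t) (c 0) ≤ variationOnFromTo c univ 0 t := by
  have hb := boundedVariationOn_of_pathLength_ne_top hc
  rw [variationOnFromTo.eq_of_le _ _ unitInterval.nonneg']
  exact (hb.mono inter_subset_left).dist_le ⟨mem_univ _, unitInterval.nonneg', le_rfl⟩
    ⟨mem_univ _, le_rfl, unitInterval.nonneg'⟩

theorem dist_le_pathLength (hc : pathLength c ≠ ⊤) (t : unitInterval) :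
    dist (c t) (c 0) ≤ (pathLength c).toReal :=
  (boundedVariationOn_of_pathLength_ne_top hc).dist_le (mem_univ _) (mem_univ _)

/-- A path which travels a distance `r` from its starting point picks up at least `a * r` from a
density which is at least `a` on the ball of radius `r` about the starting point. -/
theorem mul_le_lineIntegral (hc : pathLength c ≠ ⊤) {ρ : ℂ → ℝ≥0∞} {a : ℝ≥0∞} {r : ℝ}
    (hρ : ∀ z, dist z (c 0) ≤ r → a ≤ ρ z) {t : unitInterval} (ht : r ≤ dist (c t) (c 0)) :
    a * ENNReal.ofReal r ≤ lineIntegral ρ c := by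
  calc a * ENNReal.ofReal r = ∫⁻ _ in Icc (0 : ℝ) r, a := by simp
    _ ≤ ∫⁻ s in Icc 0 r, ρ (naturalParameterization c univ 0 s) := by
      -- The point at arc length `s ≤ r` is within distance `s` of the start, so the lower bound on
      -- the density applies.
      refine setLIntegral_mono' measurableSet_Icc fun s hs => hρ _ ?_
      obtain ⟨t', h1, h2⟩ := exists_naturalParameterization_eq hc
        ⟨hs.1, hs.2.trans (ht.trans (dist_le_pathLength hc t))⟩
      rw [h2]
      exact (dist_le_variationOnFromTo hc t').trans (h1.le.trans hs.2)
    _ ≤ lineIntegral ρ c :=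
      lintegral_mono_set (Icc_subset_Icc_right (ht.trans (dist_le_pathLength hc t)))

end PathLength

/-! ### Vertical segments -/

section Segment

/-- The vertical segment from `x - i b` to `x + i b`. -/
def verticalSegment (x b : ℝ) : PlanePath where
  toFun t := ⟨x, b * (2 * (t : ℝ) - 1)⟩
  continuous_toFun := by
    refine Complex.equivRealProdCLM.symm.continuous.comp
      (f := fun t : unitInterval => (x, b * (2 * (t : ℝ) - 1))) ?_
    fun_prop

theorem verticalSegment_zero (x b : ℝ) : verticalSegment x b 0 = ⟨x, -b⟩ := by
  refine Complex.ext rfl ?_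
  change b * (2 * 0 - 1) = -b
  ring

theorem verticalSegment_one (x b : ℝ) : verticalSegment x b 1 = ⟨x, b⟩ := by
  refine Complex.ext rfl ?_
  change b * (2 * 1 - 1) = b
  ring

theorem edist_verticalSegment (x b : ℝ) (s t : unitInterval) :
    edist (verticalSegment x b s) (verticalSegment x b t) =
      edist (2 * b * (s : ℝ)) (2 * b * (t : ℝ)) := by
  rw [edist_dist, edist_dist, Complex.dist_of_re_eq (by rfl), Real.dist_eq, Real.dist_eq]
  congr 2
  change b * (2 * (s : ℝ) - 1) - b * (2 * (t : ℝ) - 1) = _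
  ring

theorem variationOnFromTo_verticalSegment {x b : ℝ} (hb : 0 ≤ b) (t : unitInterval) :
    variationOnFromTo (verticalSegment x b) univ 0 t = 2 * b * t := by
  rw [variationOnFromTo_congr_edist (edist_verticalSegment x b),
    variationOnFromTo.eq_of_le _ _ unitInterval.nonneg']
  have hm : MonotoneOn (fun s : unitInterval => 2 * b * (s : ℝ)) univ := fun s _ t _ h =>
    mul_le_mul_of_nonneg_left (Subtype.coe_le_coe.2 h) (by positivity)
  rw [hm.eVariationOn_eq (mem_univ _) (mem_univ _)]
  simp only [Icc.coe_zero, mul_zero, sub_zero]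
  exact ENNReal.toReal_ofReal (mul_nonneg (by positivity) t.2.1)

theorem pathLength_verticalSegment {x b : ℝ} (hb : 0 ≤ b) :
    pathLength (verticalSegment x b) = ENNReal.ofReal (2 * b) := by
  have hm : MonotoneOn (fun s : unitInterval => 2 * b * (s : ℝ)) univ := fun s _ t _ h =>
    mul_le_mul_of_nonneg_left (Subtype.coe_le_coe.2 h) (by positivity)
  have hu : (univ : Set unitInterval) = univ ∩ Icc 0 1 := by
    ext t; simp [unitInterval.le_one']
  rw [pathLength, eVariationOn_congr_edist (edist_verticalSegment x b), hu,
    hm.eVariationOn_eq (mem_univ _) (mem_univ _)]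
  simp

theorem lineIntegral_verticalSegment {x b : ℝ} (hb : 0 ≤ b) (ρ : ℂ → ℝ≥0∞) :
    lineIntegral ρ (verticalSegment x b) = ∫⁻ s in Icc 0 (2 * b), ρ ⟨x, s - b⟩ := by
  have hl := pathLength_verticalSegment (x := x) hb
  rw [lineIntegral, hl, ENNReal.toReal_ofReal (by positivity)]
  refine setLIntegral_congr_fun measurableSet_Icc fun s hs => ?_
  obtain ⟨t, h1, h2⟩ := exists_naturalParameterization_eq (c := verticalSegment x b)
    (by rw [hl]; exact ENNReal.ofReal_ne_top)
    (by rw [hl, ENNReal.toReal_ofReal (by positivity)]; exact hs)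
  rw [variationOnFromTo_verticalSegment hb] at h1
  simp only [h2]
  congr 1
  refine Complex.ext rfl ?_
  change b * (2 * (t : ℝ) - 1) = s - b
  linarith

/-- This is `(a - 1 / 4)² ≥ 0`. Integrated over a length of at most `4` it replaces Cauchy–Schwarz:
the error is at most `4 / 16`, leaving `1 / 2 - 1 / 4`. -/
theorem ennreal_half_le_sq_add (a : ℝ≥0∞) : a / 2 ≤ a ^ 2 + 1 / 16 := by
  rcases eq_or_ne a ⊤ with rfl | ha
  · simp
  · lift a to ℝ≥0 using ha
    have h : a / 2 ≤ a ^ 2 + 1 / 16 := by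
      rw [← NNReal.coe_le_coe]
      push_cast
      nlinarith [sq_nonneg ((a : ℝ) - 1 / 4)]
    have h' := ENNReal.coe_le_coe.2 h
    rw [ENNReal.coe_div (by norm_num), ENNReal.coe_add, ENNReal.coe_pow,
      ENNReal.coe_div (by norm_num)] at h'
    simpa using h'

/-- A density whose integral along a vertical segment of length at most `4` is at least `1` has
square integral at least `1 / 4` along the line of this segment. -/
theorem quarter_le_lintegral_sq {x b : ℝ} (hb : 0 ≤ b) (hb2 : b ≤ 2) {ρ : ℂ → ℝ≥0∞}
    (h : 1 ≤ lineIntegral ρ (verticalSegment x b)) :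
    1 / 4 ≤ ∫⁻ y : ℝ, ρ ⟨x, y⟩ ^ 2 := by
  rw [lineIntegral_verticalSegment hb] at h
  have h1 : (1 / 2 : ℝ≥0∞) ≤ (∫⁻ y : ℝ, ρ ⟨x, y⟩ ^ 2) + 1 / 4 := by
    calc (1 / 2 : ℝ≥0∞) ≤ (∫⁻ s in Icc 0 (2 * b), ρ ⟨x, s - b⟩) / 2 := by gcongr
      _ = ∫⁻ s in Icc 0 (2 * b), ρ ⟨x, s - b⟩ / 2 := by
        simp only [div_eq_mul_inv]
        rw [lintegral_mul_const' _ _ (by simp)]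
      _ ≤ ∫⁻ s in Icc 0 (2 * b), (ρ ⟨x, s - b⟩ ^ 2 + 1 / 16) :=
        lintegral_mono fun s => ennreal_half_le_sq_add _
      _ = (∫⁻ s in Icc 0 (2 * b), ρ ⟨x, s - b⟩ ^ 2) + 1 / 16 * ENNReal.ofReal (2 * b) := by
        rw [lintegral_add_right _ measurable_const]
        simp
      _ ≤ (∫⁻ s : ℝ, ρ ⟨x, s - b⟩ ^ 2) + 1 / 16 * ENNReal.ofReal 4 := by
        gcongr
        · exact Measure.restrict_le_self
        · linarith
      _ = _ := by
        rw [lintegral_sub_right_eq_self (fun y : ℝ => ρ ⟨x, y⟩ ^ 2) b]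
        congr 1
        rw [← ENNReal.toReal_eq_toReal_iff' (by finiteness) (by finiteness)]
        simp
        norm_num
  have h2 : (1 / 2 : ℝ≥0∞) = 1 / 4 + 1 / 4 := by
    rw [← ENNReal.toReal_eq_toReal_iff' (by finiteness) (by finiteness),
      ENNReal.toReal_add (by finiteness) (by finiteness)]
    simp
    norm_num
  rw [h2] at h1
  exact (ENNReal.add_le_add_iff_right (by finiteness)).1 h1

end Segment

/-! ### Bounds for the modulus of path families -/

section Modulus

theorem modulus_mono {Γ Γ' : Set PlanePath} (h : Γ ⊆ Γ') : modulus Γ ≤ modulus Γ' :=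
  le_iInf₂ fun ρ hρ => iInf₂_le ρ ⟨hρ.1, fun c hc => hρ.2 c (h hc)⟩

/-- The image of a path under a real linear isometry of the plane. -/
noncomputable def isometryPath (σ : ℂ ≃ₗᵢ[ℝ] ℂ) (c : PlanePath) : PlanePath :=
  ⟨fun t => σ (c t), σ.continuous.comp c.continuous⟩

/-- If `ρ` is admissible for the image family, then `ρ ∘ σ` is admissible for the original one and
has the same square integral, since `σ` preserves length and area. -/
theorem modulus_le_modulus_isometry (σ : ℂ ≃ₗᵢ[ℝ] ℂ) (Γ : Set PlanePath) :
    modulus Γ ≤ modulus (isometryPath σ '' Γ) := by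
  refine le_iInf₂ fun ρ hρ => ?_
  have hed : ∀ (c : PlanePath) (s t : unitInterval),
      edist (isometryPath σ c s) (isometryPath σ c t) = edist (c s) (c t) := fun c s t =>
    σ.isometry.edist_eq _ _
  have hlen : ∀ c, pathLength (isometryPath σ c) = pathLength c := fun c =>
    eVariationOn_congr_edist (hed c) _
  have hadm : IsAdmissible (fun z => ρ (σ z)) Γ := by
    refine ⟨hρ.1.comp σ.continuous.measurable, fun c hc hfin => ?_⟩
    have := hρ.2 _ (mem_image_of_mem _ hc) (by rwa [hlen])
    rw [lineIntegral, hlen, naturalParameterization, variationOnFromTo_congr_edist (hed c)] at this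
    exact this
  refine (iInf₂_le (f := fun ρ (_ : IsAdmissible ρ Γ) => ∫⁻ z : ℂ, ρ z ^ 2) _ hadm).trans_eq ?_
  exact σ.measurePreserving.lintegral_comp (hρ.1.pow_const 2)

/-- A family of vertical segments of length at most `4` over an interval of length `R` has modulus
at least `R / 4`. -/
theorem le_modulus_verticalSegment {a R : ℝ} (b : ℝ → ℝ)
    (hb : ∀ x ∈ Icc a (a + R), 0 ≤ b x ∧ b x ≤ 2) :
    ENNReal.ofReal R / 4 ≤ modulus ((fun x => verticalSegment x (b x)) '' Icc a (a + R)) := by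
  refine le_iInf₂ fun ρ hρ => ?_
  have hm : Measurable fun p : ℝ × ℝ => ρ ⟨p.1, p.2⟩ ^ 2 :=
    (hρ.1.comp Complex.measurableEquivRealProd.symm.measurable).pow_const 2
  calc ENNReal.ofReal R / 4 = ∫⁻ _ in Icc a (a + R), (1 / 4 : ℝ≥0∞) := by
        simp [div_eq_mul_inv, mul_comm]
    -- Every vertical line over the interval contributes at least `1 / 4`; Tonelli then gives the
    -- area integral.
    _ ≤ ∫⁻ x in Icc a (a + R), ∫⁻ y : ℝ, ρ ⟨x, y⟩ ^ 2 :=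
      setLIntegral_mono' measurableSet_Icc fun x hx =>
        quarter_le_lintegral_sq (hb x hx).1 (hb x hx).2 (hρ.2 _ (mem_image_of_mem _ hx) (by
          rw [pathLength_verticalSegment (hb x hx).1]; exact ENNReal.ofReal_ne_top))
    _ ≤ ∫⁻ x : ℝ, ∫⁻ y : ℝ, ρ ⟨x, y⟩ ^ 2 := setLIntegral_le_lintegral _ _
    _ = ∫⁻ p : ℝ × ℝ, ρ ⟨p.1, p.2⟩ ^ 2 := (lintegral_prod _ hm.aemeasurable).symm
    _ = ∫⁻ z : ℂ, ρ z ^ 2 :=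
      (Complex.volume_preserving_equiv_real_prod.symm).lintegral_comp (hρ.1.pow_const 2)

/-- A family of paths, each of which starts in the ball of radius `6 r` and travels at least the
distance `r`, has modulus bounded independently of `r`. -/
theorem modulus_le_of_dist {r : ℝ} (hr : 0 < r) {Γ : Set PlanePath}
    (h : ∀ c ∈ Γ, ‖c 0‖ ≤ 6 * r ∧ ∃ t, r ≤ dist (c t) (c 0)) :
    modulus Γ ≤ ENNReal.ofReal (49 * Real.pi) := by
  -- The ball of radius `7 r = 6 r + r` contains the `r`-ball about every starting point. The
  -- density `1 / r` on it has square integral `π (7 r)² / r² = 49π`.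
  set S : Set ℂ := Metric.closedBall 0 (7 * r)
  have hS : MeasurableSet S := Metric.isClosed_closedBall.measurableSet
  have hadm : IsAdmissible (S.indicator fun _ => ENNReal.ofReal (1 / r)) Γ := by
    refine ⟨measurable_const.indicator hS, fun c hc hfin => ?_⟩
    obtain ⟨h0, t, ht⟩ := h c hc
    refine le_trans (le_of_eq ?_) (mul_le_lineIntegral hfin (a := ENNReal.ofReal (1 / r))
      (fun z hz => ?_) ht)
    · rw [← ENNReal.ofReal_mul (by positivity), one_div_mul_cancel hr.ne', ENNReal.ofReal_one]
    · rw [indicator_of_mem]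
      rw [Metric.mem_closedBall, dist_zero_right]
      have h1 : ‖z‖ ≤ ‖z - c 0‖ + ‖c 0‖ := by simpa using norm_add_le (z - c 0) (c 0)
      rw [dist_eq_norm] at hz
      linarith
  refine (iInf₂_le (f := fun ρ (_ : IsAdmissible ρ Γ) => ∫⁻ z : ℂ, ρ z ^ 2) _ hadm).trans ?_
  have h2 : ∀ z, S.indicator (fun _ => ENNReal.ofReal (1 / r)) z ^ 2 =
      S.indicator (fun _ => ENNReal.ofReal (1 / r) ^ 2) z := fun z => by
    by_cases hz : z ∈ S <;> simp [hz]
  simp only [h2]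
  rw [lintegral_indicator_const hS, Complex.volume_closedBall, ← ENNReal.ofReal_pow (by positivity),
    ← ENNReal.ofReal_pow (by positivity)]
  have hpi : (NNReal.pi : ℝ≥0∞) = ENNReal.ofReal Real.pi := by
    rw [← NNReal.coe_real_pi, ENNReal.ofReal_coe_nnreal]
  rw [hpi, ← ENNReal.ofReal_mul (by positivity), ← ENNReal.ofReal_mul (by positivity)]
  apply ENNReal.ofReal_le_ofReal
  apply le_of_eq
  field_simp
  ring

end Modulus

/-! ### The map as an inverse of the hyperbolic sine, and its image -/

/-- The conformal map `z ↦ -i arcsin (i (z + 1) / 2)` of the half-plane. -/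
noncomputable def halfStripMap (z : ℂ) : ℂ :=
  -Complex.I * arcsin (Complex.I * (z + 1) / 2)

/-- The square root occurring in `halfStripMap`. -/
noncomputable def halfStripRoot (z : ℂ) : ℂ := (1 + ((z + 1) / 2) ^ 2) ^ (1 / 2 : ℂ)

theorem halfStripMap_eq_neg_log (z : ℂ) :
    halfStripMap z = -Complex.log (halfStripRoot z - (z + 1) / 2) := by
  have h1 : Complex.I * (Complex.I * (z + 1) / 2) = -((z + 1) / 2) := by
    linear_combination (z + 1) / 2 * Complex.I_sq
  have h2 : 1 - (Complex.I * (z + 1) / 2) ^ 2 = 1 + ((z + 1) / 2) ^ 2 := by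
    linear_combination -((z + 1) / 2) ^ 2 * Complex.I_sq
  rw [halfStripMap, arcsin, h1, h2, halfStripRoot, neg_add_eq_sub]
  linear_combination Complex.log ((1 + ((z + 1) / 2) ^ 2) ^ (1 / 2 : ℂ) - (z + 1) / 2) *
    Complex.I_sq

section Inverse

variable {z : ℂ}

theorem half_add_one_re (z : ℂ) : ((z + 1) / 2).re = (z.re + 1) / 2 := by
  simp

theorem one_add_sq_mem_slitPlane {ζ : ℂ} (hζ : 0 < ζ.re) : 1 + ζ ^ 2 ∈ Complex.slitPlane := by
  rw [Complex.mem_slitPlane_iff]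
  by_cases h : ζ.im = 0
  · left
    simp only [pow_two, Complex.add_re, Complex.one_re, Complex.mul_re, h]
    linarith [mul_self_pos.2 hζ.ne']
  · right
    simp only [pow_two, Complex.add_im, Complex.one_im, Complex.mul_im]
    have : ζ.re * ζ.im ≠ 0 := mul_ne_zero hζ.ne' h
    intro h0
    apply this
    linarith

theorem halfStripRoot_sq (z : ℂ) : halfStripRoot z ^ 2 = 1 + ((z + 1) / 2) ^ 2 := by
  rw [halfStripRoot, one_div]
  exact Complex.cpow_nat_inv_pow _ two_ne_zero

/-- The principal root halves the argument, which then lies strictly between `-π / 2` and `π / 2`.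
-/
theorem cpow_half_re_pos {w : ℂ} (hw : w ∈ Complex.slitPlane) : 0 < (w ^ (1 / 2 : ℂ)).re := by
  have h0 := Complex.slitPlane_ne_zero hw
  rw [Complex.cpow_def_of_ne_zero h0, Complex.exp_re]
  refine mul_pos (Real.exp_pos _) (Real.cos_pos_of_mem_Ioo ?_)
  have him : (Complex.log w * (1 / 2)).im = w.arg / 2 := by
    rw [← Complex.log_im, show (1 / 2 : ℂ) = ((1 / 2 : ℝ) : ℂ) by norm_num, Complex.im_mul_ofReal]
    ring
  have h1 := Complex.neg_pi_lt_arg w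
  have h2 := (Complex.arg_le_pi w).lt_of_ne (Complex.mem_slitPlane_iff_arg.1 hw).1
  rw [him]
  constructor <;> linarith

theorem half_add_one_re_pos (hz : -1 < z.re) : 0 < ((z + 1) / 2).re := by
  rw [half_add_one_re]; linarith

theorem halfStripRoot_re_pos (hz : -1 < z.re) : 0 < (halfStripRoot z).re :=
  cpow_half_re_pos (one_add_sq_mem_slitPlane (half_add_one_re_pos hz))

theorem halfStripRoot_sub_mul_add (z : ℂ) :
    (halfStripRoot z - (z + 1) / 2) * (halfStripRoot z + (z + 1) / 2) = 1 := by
  linear_combination halfStripRoot_sq z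

/-- The difference is the inverse of `halfStripRoot z + (z + 1) / 2`, whose real part is positive,
and inversion preserves the right half-plane. -/
theorem halfStripRoot_sub_re_pos (hz : -1 < z.re) : 0 < (halfStripRoot z - (z + 1) / 2).re := by
  have hm : 0 < (halfStripRoot z + (z + 1) / 2).re := by
    rw [Complex.add_re]
    exact add_pos (halfStripRoot_re_pos hz) (half_add_one_re_pos hz)
  rw [eq_inv_of_mul_eq_one_left (halfStripRoot_sub_mul_add z), Complex.inv_re]
  refine div_pos hm (Complex.normSq_pos.2 fun h => ?_)
  rw [h] at hm
  simp at hm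

theorem ne_zero_of_re_pos {w : ℂ} (hw : 0 < w.re) : w ≠ 0 := by
  rintro rfl
  simp at hw

theorem sinh_halfStripMap (hz : -1 < z.re) : Complex.sinh (halfStripMap z) = (z + 1) / 2 := by
  have h0 := ne_zero_of_re_pos (halfStripRoot_sub_re_pos hz)
  have h1 : Complex.exp (-halfStripMap z) = halfStripRoot z - (z + 1) / 2 := by
    rw [halfStripMap_eq_neg_log, neg_neg, Complex.exp_log h0]
  have h2 : Complex.exp (halfStripMap z) = halfStripRoot z + (z + 1) / 2 := by
    rw [← neg_neg (halfStripMap z), Complex.exp_neg, h1]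
    exact inv_eq_of_mul_eq_one_right (halfStripRoot_sub_mul_add z)
  rw [Complex.sinh, h1, h2]
  ring

theorem abs_im_halfStripMap_lt (hz : -1 < z.re) : |(halfStripMap z).im| < Real.pi / 2 := by
  rw [halfStripMap_eq_neg_log, Complex.neg_im, abs_neg, Complex.log_im]
  exact Complex.abs_arg_lt_pi_div_two_iff.2 (Or.inl (halfStripRoot_sub_re_pos hz))

theorem sinh_re (w : ℂ) : (Complex.sinh w).re = Real.sinh w.re * Real.cos w.im := by
  conv_lhs => rw [← Complex.re_add_im w]
  rw [Complex.sinh_add, Complex.sinh_mul_I, Complex.cosh_mul_I, ← Complex.ofReal_sinh,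
    ← Complex.ofReal_cosh, ← Complex.ofReal_sin, ← Complex.ofReal_cos]
  simp only [Complex.add_re, Complex.re_ofReal_mul, Complex.ofReal_re, Complex.I_re, mul_zero,
    add_zero]

theorem cosh_re (w : ℂ) : (Complex.cosh w).re = Real.cosh w.re * Real.cos w.im := by
  conv_lhs => rw [← Complex.re_add_im w]
  rw [Complex.cosh_add, Complex.sinh_mul_I, Complex.cosh_mul_I, ← Complex.ofReal_sinh,
    ← Complex.ofReal_cosh, ← Complex.ofReal_sin, ← Complex.ofReal_cos]
  simp only [Complex.add_re, Complex.re_ofReal_mul, Complex.ofReal_re, Complex.I_re, mul_zero,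
    add_zero]

/-- On the strip `cosh w` has positive real part, so it is the principal root of `1 + sinh² w`. -/
theorem halfStripMap_sinh {w : ℂ} (hw : |w.im| < Real.pi / 2) :
    halfStripMap (2 * Complex.sinh w - 1) = w := by
  obtain ⟨hw1, hw2⟩ := abs_lt.1 hw
  have hcosh : 0 < (Complex.cosh w).re := by
    rw [cosh_re]
    exact mul_pos (Real.cosh_pos _) (Real.cos_pos_of_mem_Ioo ⟨hw1, hw2⟩)
  have h1 : (2 * Complex.sinh w - 1 + 1) / 2 = Complex.sinh w := by ring
  have h2 : halfStripRoot (2 * Complex.sinh w - 1) = Complex.cosh w := by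
    rw [halfStripRoot, h1, add_comm, ← Complex.cosh_sq, one_div]
    exact Complex.sq_cpow_two_inv hcosh
  rw [halfStripMap_eq_neg_log, h1, h2, Complex.cosh_sub_sinh, Complex.log_exp, neg_neg]
  · rw [Complex.neg_im]; linarith [Real.pi_pos]
  · rw [Complex.neg_im]; linarith [Real.pi_pos]

theorem injOn_halfStripMap : InjOn halfStripMap {z | -1 < z.re} := fun z hz w hw h => by
  have h1 := sinh_halfStripMap hz
  rw [h, sinh_halfStripMap hw] at h1
  linear_combination -2 * h1

/-- A general set `T` of real parts covers both the half-plane (`T = Ioi 0`) and its boundary line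
(`T = {0}`). -/
theorem image_halfStripMap (T : Set ℝ) (hT : T ⊆ Ioi (-1)) :
    halfStripMap '' {z | z.re ∈ T} =
      {w | |w.im| < Real.pi / 2 ∧ 2 * (Real.sinh w.re * Real.cos w.im) - 1 ∈ T} := by
  ext w
  constructor
  · rintro ⟨z, hz, rfl⟩
    refine ⟨abs_im_halfStripMap_lt (hT hz), ?_⟩
    rw [← sinh_re, sinh_halfStripMap (hT hz), half_add_one_re, mul_div_cancel₀ _ two_ne_zero, add_sub_cancel_right]
    exact hz
  · rintro ⟨h1, h2⟩
    refine ⟨2 * Complex.sinh w - 1, ?_, halfStripMap_sinh h1⟩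
    rw [mem_ofPred_eq]
    rw [← sinh_re] at h2
    simpa using h2

/-- The image of the half-plane under `halfStripMap`. -/
def halfStrip : Set ℂ :=
  {w | |w.im| < Real.pi / 2 ∧ 1 / 2 < Real.sinh w.re * Real.cos w.im}

/-- The boundary of `halfStrip` in the plane. -/
def halfStripBoundary : Set ℂ :=
  {w | |w.im| < Real.pi / 2 ∧ Real.sinh w.re * Real.cos w.im = 1 / 2}

theorem image_halfStripMap_rightHalfPlane : halfStripMap '' rightHalfPlane = halfStrip := by
  refine (image_halfStripMap (Ioi 0) (Ioi_subset_Ioi (by norm_num))).trans ?_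
  ext w
  simp only [halfStrip, mem_ofPred_eq, mem_Ioi]
  refine and_congr_right fun _ => ⟨fun h => by linarith, fun h => by linarith⟩

theorem image_halfStripMap_imaginaryAxis :
    halfStripMap '' {z | z.re = 0} = halfStripBoundary := by
  refine (image_halfStripMap {0} (by simp)).trans ?_
  ext w
  simp only [halfStripBoundary, mem_ofPred_eq, mem_singleton_iff]
  refine and_congr_right fun _ => ⟨fun h => by linarith, fun h => by linarith⟩

theorem norm_sinh_le (w : ℂ) : ‖Complex.sinh w‖ ≤ Real.exp ‖w‖ := by
  rw [Complex.sinh, norm_div, Complex.norm_ofNat, div_le_iff₀ two_pos]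
  have h1 := Complex.norm_exp_le_exp_norm w
  have h2 := Complex.norm_exp_le_exp_norm (-w)
  rw [norm_neg] at h2
  linarith [norm_sub_le (Complex.exp w) (Complex.exp (-w))]

/-- A bounded value of the map forces a bounded argument, so the map tends to `∞` at `∞`. -/
theorem norm_le_exp_norm_halfStripMap (hz : -1 < z.re) :
    ‖z‖ ≤ 2 * Real.exp ‖halfStripMap z‖ + 1 := by
  have h1 : z = 2 * Complex.sinh (halfStripMap z) - 1 := by
    rw [sinh_halfStripMap hz]; ring
  have h2 := norm_sub_le (2 * Complex.sinh (halfStripMap z)) 1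
  rw [← h1, norm_mul, Complex.norm_ofNat, norm_one] at h2
  linarith [norm_sinh_le (halfStripMap z)]

theorem tendsto_halfStripMap :
    Tendsto halfStripMap (Bornology.cobounded ℂ ⊓ 𝓟 {z | -1 < z.re}) (Bornology.cobounded ℂ) := by
  rw [← tendsto_norm_atTop_iff_cobounded, tendsto_atTop]
  intro M
  rw [eventually_inf_principal]
  filter_upwards [tendsto_norm_cobounded_atTop.eventually_gt_atTop (2 * Real.exp M + 1)]
    with z hz hre
  have h := norm_le_exp_norm_halfStripMap hre
  have h2 : Real.exp M < Real.exp ‖halfStripMap z‖ := by linarith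
  exact (Real.exp_lt_exp.1 h2).le

end Inverse

/-! ### Derivatives and the Schwarzian -/

section Derivatives

variable {z : ℂ}

theorem hasDerivAt_half_add_one (z : ℂ) : HasDerivAt (fun z : ℂ => (z + 1) / 2) (1 / 2) z :=
  ((hasDerivAt_id z).add_const 1).div_const 2

theorem hasDerivAt_halfStripRoot (hz : -1 < z.re) :
    HasDerivAt halfStripRoot ((z + 1) / 2 / (2 * halfStripRoot z)) z := by
  have h0 := ne_zero_of_re_pos (halfStripRoot_re_pos hz)
  have hs := one_add_sq_mem_slitPlane (half_add_one_re_pos hz)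
  have h := ((((hasDerivAt_half_add_one z).pow 2).const_add 1).cpow_const
    (c := (1 / 2 : ℂ)) hs)
  refine h.congr_deriv ?_
  simp only [Pi.pow_apply]
  rw [Complex.cpow_sub _ _ (Complex.slitPlane_ne_zero hs), Complex.cpow_one,
    ← halfStripRoot_sq z]
  rw [halfStripRoot_sq]
  change 1 / 2 * (halfStripRoot z / _) * _ = _
  rw [← halfStripRoot_sq z]
  field_simp
  ring

theorem hasDerivAt_halfStripMap (hz : -1 < z.re) :
    HasDerivAt halfStripMap (1 / (2 * halfStripRoot z)) z := by
  have h0 := ne_zero_of_re_pos (halfStripRoot_re_pos hz)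
  have hp := halfStripRoot_sub_re_pos hz
  have hp0 := ne_zero_of_re_pos hp
  have h := (((hasDerivAt_halfStripRoot hz).sub (hasDerivAt_half_add_one z)).clog
    (Or.inl hp)).neg
  rw [funext halfStripMap_eq_neg_log]
  refine h.congr_deriv ?_
  simp only [Pi.sub_apply]
  generalize halfStripRoot z = q at *
  generalize (z + 1) / 2 = ζ at *
  field_simp
  ring

theorem eventually_neg_one_lt_re (hz : -1 < z.re) : ∀ᶠ w : ℂ in 𝓝 z, -1 < w.re :=
  Complex.continuous_re.continuousAt.eventually (lt_mem_nhds hz)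

theorem deriv_halfStripMap (hz : -1 < z.re) :
    deriv halfStripMap z = 1 / (2 * halfStripRoot z) := (hasDerivAt_halfStripMap hz).deriv

theorem preSchwarzian_halfStripMap (hz : -1 < z.re) :
    preSchwarzian halfStripMap z = -((z + 1) / 2) / (2 * (1 + ((z + 1) / 2) ^ 2)) := by
  have h0 := ne_zero_of_re_pos (halfStripRoot_re_pos hz)
  have he : deriv halfStripMap =ᶠ[𝓝 z] fun w => (2 * halfStripRoot w)⁻¹ := by
    filter_upwards [eventually_neg_one_lt_re hz] with w hw
    rw [deriv_halfStripMap hw, one_div]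
  have hd := ((hasDerivAt_halfStripRoot hz).const_mul 2).inv (by simpa using h0)
  have hd' : deriv (fun w : ℂ => (2 * halfStripRoot w)⁻¹) z = _ := hd.deriv
  rw [preSchwarzian, he.deriv_eq, hd', deriv_halfStripMap hz, ← halfStripRoot_sq]
  generalize halfStripRoot z = q at *
  generalize (z + 1) / 2 = ζ at *
  field_simp

theorem schwarzian_halfStripMap (hz : -1 < z.re) :
    schwarzian halfStripMap z =
      (((z + 1) / 2) ^ 2 - 2) / (8 * (1 + ((z + 1) / 2) ^ 2) ^ 2) := by
  have hs := Complex.slitPlane_ne_zero (one_add_sq_mem_slitPlane (half_add_one_re_pos hz))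
  have he : preSchwarzian halfStripMap =ᶠ[𝓝 z]
      fun w => -((w + 1) / 2) / (2 * (1 + ((w + 1) / 2) ^ 2)) := by
    filter_upwards [eventually_neg_one_lt_re hz] with w hw
    exact preSchwarzian_halfStripMap hw
  have hd := (hasDerivAt_half_add_one z).neg.div
    ((((hasDerivAt_half_add_one z).pow 2).const_add 1).const_mul 2) (by simpa using hs)
  have hd' : deriv (fun w : ℂ => -((w + 1) / 2) / (2 * (1 + ((w + 1) / 2) ^ 2))) z = _ := hd.deriv
  rw [schwarzian, he.deriv_eq, hd', preSchwarzian_halfStripMap hz]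
  simp only [Pi.neg_apply, Pi.pow_apply]
  generalize (z + 1) / 2 = ζ at *
  field_simp
  ring

/-- Factor `1 + ζ²` as `(ζ - i)(ζ + i)`; both zeros lie on the imaginary axis, at distance at least
`1 / 2` from `ζ`. -/
theorem norm_one_add_sq_ge {ζ : ℂ} (hζ : 1 / 2 ≤ ζ.re) : 1 / 4 ≤ ‖1 + ζ ^ 2‖ := by
  have h : 1 + ζ ^ 2 = (ζ - Complex.I) * (ζ + Complex.I) := by
    linear_combination Complex.I_sq
  have h1 : 1 / 2 ≤ ‖ζ - Complex.I‖ := by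
    refine le_trans ?_ (Complex.re_le_norm _)
    simpa using hζ
  have h2 : 1 / 2 ≤ ‖ζ + Complex.I‖ := by
    refine le_trans ?_ (Complex.re_le_norm _)
    simpa using hζ
  rw [h, norm_mul]
  nlinarith

theorem norm_schwarzian_halfStripMap_le (hz : 0 < z.re) : ‖schwarzian halfStripMap z‖ ≤ 8 := by
  rw [schwarzian_halfStripMap (by linarith)]
  have hζ : 1 / 2 ≤ ((z + 1) / 2).re := by rw [half_add_one_re]; linarith
  generalize (z + 1) / 2 = ζ at *
  have h1 := norm_one_add_sq_ge hζ
  have h2 : ‖ζ ^ 2 - 2‖ ≤ ‖1 + ζ ^ 2‖ + 3 := by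
    have := norm_sub_le (1 + ζ ^ 2) 3
    rw [Complex.norm_ofNat] at this
    rwa [show ζ ^ 2 - 2 = 1 + ζ ^ 2 - 3 by ring]
  rw [norm_div, norm_mul, norm_pow, Complex.norm_ofNat, div_le_iff₀ (by positivity)]
  -- With `t = ‖1 + ζ ^ 2‖ ≥ 1 / 4` the claim follows from `t + 3 ≤ 64 t²`.
  nlinarith

/-- The filter restricts only the real part, which encodes uniformity in the imaginary part. -/
theorem tendsto_schwarzian_halfStripMap :
    Tendsto (fun z : ℂ => (2 * z.re) ^ 2 * ‖schwarzian halfStripMap z‖)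
      (comap Complex.re (𝓝[>] 0)) (𝓝 0) := by
  have hre : Tendsto Complex.re (comap Complex.re (𝓝[>] 0)) (𝓝[>] 0) := tendsto_comap
  have h1 : Tendsto (fun z : ℂ => (2 * z.re) ^ 2 * 8) (comap Complex.re (𝓝[>] 0)) (𝓝 0) := by
    have := (((hre.mono_right nhdsWithin_le_nhds).const_mul 2).pow 2).mul_const 8
    simpa using this
  refine squeeze_zero' (Eventually.of_forall fun z => by positivity) ?_ h1
  filter_upwards [hre.eventually self_mem_nhdsWithin] with z hz
  gcongr
  exact norm_schwarzian_halfStripMap_le hz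

theorem rightHalfPlane_subset : rightHalfPlane ⊆ {z : ℂ | -1 < z.re} := fun _ hz =>
  (by norm_num : (-1 : ℝ) < 0).trans hz

theorem isConformalMapOn_halfStripMap : IsConformalMapOn halfStripMap rightHalfPlane :=
  ⟨fun _ hz => (hasDerivAt_halfStripMap
      (rightHalfPlane_subset hz)).differentiableAt.differentiableWithinAt,
    injOn_halfStripMap.mono rightHalfPlane_subset⟩

end Derivatives

/-! ### Frontiers, paths and Jordan curves in the sphere -/

section SphereTopology

theorem frontier_toSphere {U : Set ℂ} (hU : (Bornology.cobounded ℂ ⊓ 𝓟 U).NeBot) :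
    frontier (toSphere U) = insert OnePoint.infty (toSphere (frontier U)) := by
  have hpre : (fun z : ℂ => (z : Sphere)) ⁻¹' frontier (toSphere U) = frontier U := by
    rw [OnePoint.isOpenMap_coe.preimage_frontier_eq_frontier_preimage OnePoint.continuous_coe,
      toSphere, preimage_image_eq _ OnePoint.coe_injective]
  have hinf : OnePoint.infty ∈ frontier (toSphere U) := by
    refine ⟨?_, fun h => OnePoint.infty_notMem_image_coe (interior_subset h)⟩
    refine mem_closure_of_tendsto (b := Bornology.cobounded ℂ ⊓ 𝓟 U)
      (f := fun z : ℂ => (z : Sphere)) ?_ ?_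
    · refine Tendsto.mono_left ?_ inf_le_left
      rw [Metric.cobounded_eq_cocompact, ← coclosedCompact_eq_cocompact]
      exact OnePoint.tendsto_coe_infty
    · exact eventually_inf_principal.2 (Eventually.of_forall fun z hz => mem_image_of_mem _ hz)
  ext p
  induction p using OnePoint.rec with
  | infty => simp [hinf]
  | coe z =>
    rw [← mem_preimage (f := fun z : ℂ => (z : Sphere)), hpre]
    simp [toSphere]

/-- A path in the sphere avoiding `∞` is a path in the plane. -/
theorem exists_planePath {G : unitInterval → Sphere} (hG : Continuous G)
    (h : ∀ t, G t ≠ OnePoint.infty) : ∃ d : PlanePath, ∀ t, (d t : Sphere) = G t := by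
  choose d hd using fun t => OnePoint.ne_infty_iff_exists.1 (h t)
  refine ⟨⟨d, OnePoint.isOpenEmbedding_coe.isInducing.continuous_iff.2 ?_⟩, hd⟩
  exact hG.congr fun t => (hd t).symm

/-- A proper injective line extends to the one-point compactification of `ℝ`, which is a circle. -/
theorem isJordanCurve_of_line {g : ℝ → ℂ} (hg : Continuous g) (hinj : Function.Injective g)
    (hlim : Tendsto g (cocompact ℝ) (cocompact ℂ)) :
    IsJordanCurve (insert OnePoint.infty (toSphere (range g))) := by
  let e : OnePoint ℝ ≃ₜ Metric.sphere (0 : EuclideanSpace ℝ (Fin 2)) 1 :=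
    onePointEquivSphereOfFinrankEq (by simp)
  let u : Circle → Metric.sphere (0 : EuclideanSpace ℝ (Fin 2)) 1 := fun z =>
    ⟨Complex.orthonormalBasisOneI.repr (z : ℂ), by simp [Circle.norm_coe]⟩
  have hu : Continuous u := (Complex.orthonormalBasisOneI.repr.continuous.comp
    continuous_subtype_val).subtype_mk _
  have huinj : Function.Injective u := fun z w h =>
    Circle.coe_injective (Complex.orthonormalBasisOneI.repr.injective (congrArg Subtype.val h))
  have husurj : Function.Surjective u := fun p => by
    refine ⟨⟨Complex.orthonormalBasisOneI.repr.symm p.1, ?_⟩, ?_⟩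
    · refine mem_sphere_zero_iff_norm.2 ?_
      rw [LinearIsometryEquiv.norm_map]
      exact mem_sphere_zero_iff_norm.1 p.2
    · exact Subtype.ext (Complex.orthonormalBasisOneI.repr.apply_symm_apply p.1)
  have hmap : Continuous (OnePoint.map g) := OnePoint.continuous_map hg (by
    rw [coclosedCompact_eq_cocompact, coclosedCompact_eq_cocompact]; exact hlim)
  refine ⟨fun z => OnePoint.map g (e.symm (u z)), hmap.comp (e.symm.continuous.comp hu), ?_, ?_⟩
  · exact (Option.map_injective hinj).comp (e.symm.injective.comp huinj)
  · have hsurj : Function.Surjective fun z => e.symm (u z) := e.symm.surjective.comp husurj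
    change range (OnePoint.map g ∘ fun z => e.symm (u z)) = _
    rw [hsurj.range_comp]
    ext p
    constructor
    · rintro ⟨q, rfl⟩
      induction q using OnePoint.rec with
      | infty => exact mem_insert _ _
      | coe t => exact mem_insert_of_mem _ ⟨g t, mem_range_self t, rfl⟩
    · rintro (rfl | ⟨_, ⟨t, rfl⟩, rfl⟩)
      · exact ⟨OnePoint.infty, rfl⟩
      · exact ⟨(t : OnePoint ℝ), rfl⟩

end SphereTopology

/-! ### The half-strip as a Jordan domain, and its cross-cuts -/

section HalfStrip

theorem isOpen_halfStrip : IsOpen halfStrip := by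
  rw [halfStrip, ofPred_and]
  exact (isOpen_lt (by fun_prop) continuous_const).inter
    (isOpen_lt continuous_const (by fun_prop))

theorem frontier_rightHalfPlane : frontier rightHalfPlane = {z : ℂ | z.re = 0} :=
  Complex.frontier_setOfPred_lt_re 0

theorem frontier_halfStrip : frontier halfStrip = halfStripBoundary := by
  apply Subset.antisymm
  · rw [isOpen_halfStrip.frontier_eq]
    rintro w ⟨hw, hnot⟩
    have hcl : IsClosed {w : ℂ | |w.im| ≤ Real.pi / 2 ∧ 1 / 2 ≤ Real.sinh w.re * Real.cos w.im} := by
      rw [ofPred_and]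
      exact (isClosed_le (by fun_prop) continuous_const).inter
        (isClosed_le continuous_const (by fun_prop))
    have hsub : halfStrip ⊆ _ := fun v hv => And.intro hv.1.le hv.2.le
    obtain ⟨h1, h2⟩ := closure_minimal hsub hcl hw
    -- On the lines `|Im w| = π / 2` the cosine vanishes, so they contribute no boundary points.
    have h3 : |w.im| < Real.pi / 2 := by
      refine h1.lt_of_ne fun h => ?_
      rw [← Real.cos_abs, h, Real.cos_pi_div_two, mul_zero] at h2
      norm_num at h2
    exact ⟨h3, le_antisymm (not_lt.1 fun h => hnot ⟨h3, h⟩) h2⟩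
  · rw [isOpen_halfStrip.frontier_eq]
    intro w hw
    refine ⟨?_, fun h => h.2.ne' hw.2⟩
    rw [← image_halfStripMap_imaginaryAxis] at hw
    obtain ⟨z, hz, rfl⟩ := hw
    have hz1 : -1 < z.re := by rw [show z.re = 0 from hz]; norm_num
    rw [← image_halfStripMap_rightHalfPlane]
    -- The map is continuous across the imaginary axis, so it sends points of the axis to limits of
    -- image points.
    refine (hasDerivAt_halfStripMap hz1).continuousAt.continuousWithinAt.mem_closure_image ?_
    refine frontier_subset_closure ?_
    rw [frontier_rightHalfPlane]
    exact hz

theorem neBot_cobounded_of_real {U : Set ℂ} {a : ℝ} (h : ∀ x : ℝ, a ≤ x → (x : ℂ) ∈ U) :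
    (Bornology.cobounded ℂ ⊓ 𝓟 U).NeBot := by
  have ht : Tendsto (fun x : ℝ => (x : ℂ)) atTop (Bornology.cobounded ℂ ⊓ 𝓟 U) := by
    refine tendsto_inf.2 ⟨?_, tendsto_principal.2 ((eventually_ge_atTop a).mono h)⟩
    rw [← tendsto_norm_atTop_iff_cobounded]
    simpa using tendsto_abs_atTop_atTop
  exact ht.neBot

theorem frontier_toSphere_rightHalfPlane :
    frontier (toSphere rightHalfPlane) =
      insert OnePoint.infty (toSphere {z : ℂ | z.re = 0}) := by
  rw [frontier_toSphere (neBot_cobounded_of_real (a := 1) fun x hx => ?_), frontier_rightHalfPlane]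
  exact zero_lt_one.trans_le hx

theorem frontier_toSphere_halfStrip :
    frontier (toSphere halfStrip) = insert OnePoint.infty (toSphere halfStripBoundary) := by
  rw [frontier_toSphere (neBot_cobounded_of_real (a := 1) fun x hx => ?_), frontier_halfStrip]
  refine ⟨by simp [Real.pi_pos], ?_⟩
  rw [Complex.ofReal_re, Complex.ofReal_im, Real.cos_zero, mul_one]
  linarith [Real.self_le_sinh_iff.2 (zero_le_one.trans hx)]

theorem isJordanDomain_halfStrip : IsJordanDomain (toSphere halfStrip) := by
  refine ⟨OnePoint.isOpen_image_coe.2 isOpen_halfStrip, ?_, ?_⟩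
  · refine IsConnected.image ?_ _ OnePoint.continuous_coe.continuousOn
    rw [← image_halfStripMap_rightHalfPlane]
    refine IsConnected.image ?_ _ fun z hz =>
      (hasDerivAt_halfStripMap (rightHalfPlane_subset hz)).continuousAt.continuousWithinAt
    exact ⟨⟨1, by simp [rightHalfPlane]⟩, (convex_halfSpace_re_gt 0).isPreconnected⟩
  · have hline : ∀ t : ℝ, -1 < ((t : ℂ) * Complex.I).re := fun t => by simp
    have hrange : halfStripBoundary = range fun t : ℝ => halfStripMap (t * Complex.I) := by
      rw [← image_halfStripMap_imaginaryAxis]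
      ext w
      constructor
      · rintro ⟨z, hz, rfl⟩
        exact ⟨z.im, congrArg halfStripMap
          (Complex.ext (by simpa using Eq.symm hz) (by simp))⟩
      · rintro ⟨t, rfl⟩
        exact ⟨t * Complex.I, by simp, rfl⟩
    rw [frontier_toSphere_halfStrip, hrange]
    refine isJordanCurve_of_line ?_ ?_ ?_
    · rw [continuous_iff_continuousAt]
      intro t
      exact ContinuousAt.comp (f := fun t : ℝ => (t : ℂ) * Complex.I)
        (hasDerivAt_halfStripMap (hline t)).continuousAt (by fun_prop)
    · intro s t h
      have := injOn_halfStripMap (hline s) (hline t) h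
      simpa using this
    · rw [← Metric.cobounded_eq_cocompact, ← Metric.cobounded_eq_cocompact]
      refine tendsto_halfStripMap.comp (tendsto_inf.2 ⟨?_, tendsto_principal.2
        (Eventually.of_forall hline)⟩)
      rw [← tendsto_norm_atTop_iff_cobounded]
      refine tendsto_norm_cobounded_atTop.congr fun t => ?_
      simp

/-- The half-width of `halfStrip` at abscissa `x`. -/
noncomputable def halfWidth (x : ℝ) : ℝ := Real.arccos (1 / (2 * Real.sinh x))

theorem sinh_mul_cos_halfWidth {x : ℝ} (hx : 2 ≤ x) :
    Real.sinh x * Real.cos (halfWidth x) = 1 / 2 := by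
  have h := Real.self_le_sinh_iff.2 (zero_le_two.trans hx)
  have hpos : 0 < Real.sinh x := by linarith
  have h0 : (0 : ℝ) ≤ 1 / (2 * Real.sinh x) := by positivity
  rw [halfWidth, Real.cos_arccos (by linarith) (by rw [div_le_one (by positivity)]; linarith)]
  field_simp

theorem halfWidth_nonneg (x : ℝ) : 0 ≤ halfWidth x := Real.arccos_nonneg _

theorem halfWidth_lt {x : ℝ} (hx : 2 ≤ x) : halfWidth x < Real.pi / 2 := by
  have h := Real.self_le_sinh_iff.2 (zero_le_two.trans hx)
  have hpos : 0 < Real.sinh x := by linarith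
  rw [halfWidth, Real.arccos_lt_pi_div_two]
  positivity

theorem verticalSegment_mem_halfStripBoundary {x : ℝ} (hx : 2 ≤ x) :
    verticalSegment x (halfWidth x) 0 ∈ halfStripBoundary ∧
      verticalSegment x (halfWidth x) 1 ∈ halfStripBoundary := by
  rw [verticalSegment_zero, verticalSegment_one]
  have hlt : |halfWidth x| < Real.pi / 2 := by
    rw [abs_of_nonneg (halfWidth_nonneg x)]
    exact halfWidth_lt hx
  exact ⟨⟨by rwa [abs_neg], by rw [Real.cos_neg]; exact sinh_mul_cos_halfWidth hx⟩,
    ⟨hlt, sinh_mul_cos_halfWidth hx⟩⟩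

theorem verticalSegment_mem {x : ℝ} (hx : 2 ≤ x) (t : unitInterval) :
    verticalSegment x (halfWidth x) t ∈ halfStrip ∪ halfStripBoundary := by
  have h := Real.self_le_sinh_iff.2 (zero_le_two.trans hx)
  have hb := halfWidth_nonneg x
  have hlt := halfWidth_lt hx
  have habs : |halfWidth x * (2 * (t : ℝ) - 1)| ≤ halfWidth x := by
    rw [abs_mul, abs_of_nonneg hb]
    refine mul_le_of_le_one_right hb ?_
    rw [abs_le]
    constructor <;> linarith [t.2.1, t.2.2]
  have hcos : Real.cos (halfWidth x) ≤ Real.cos (halfWidth x * (2 * (t : ℝ) - 1)) := by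
    rw [← Real.cos_abs (halfWidth x * _)]
    exact Real.cos_le_cos_of_nonneg_of_le_pi (abs_nonneg _) (by linarith [Real.pi_pos]) habs
  have hge : 1 / 2 ≤ Real.sinh x * Real.cos (halfWidth x * (2 * (t : ℝ) - 1)) := by
    rw [← sinh_mul_cos_halfWidth hx]
    exact mul_le_mul_of_nonneg_left hcos (by linarith)
  rcases hge.lt_or_eq with h' | h'
  · exact Or.inl ⟨habs.trans_lt hlt, h'⟩
  · exact Or.inr ⟨habs.trans_lt hlt, h'.symm⟩

end HalfStrip

/-! ### The half-strip is not a quasidisk -/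

section NotQuasidisk

/-- The reflection in the imaginary axis. -/
noncomputable def axisReflection : ℂ ≃ₗᵢ[ℝ] ℂ :=
  Complex.conjLIE.trans (LinearIsometryEquiv.neg ℝ)

theorem axisReflection_re (z : ℂ) : (axisReflection z).re = -z.re := by
  simp [axisReflection]

theorem axisReflection_eq_self {z : ℂ} (hz : z.re = 0) : axisReflection z = z :=
  Complex.ext (by rw [axisReflection_re, hz, neg_zero]) (by simp [axisReflection])

variable {F : Sphere ≃ₜ Sphere}

theorem coe_mem_toSphere {s : Set ℂ} {z : ℂ} : (z : Sphere) ∈ toSphere s ↔ z ∈ s := by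
  simp [toSphere]

theorem apply_mem_halfStrip_iff (hF : F '' toSphere rightHalfPlane = toSphere halfStrip) (z : ℂ) :
    F z ∈ toSphere halfStrip ↔ 0 < z.re := by
  rw [← hF, F.injective.mem_set_image, coe_mem_toSphere]
  rfl

theorem apply_mem_frontier_iff (hF : F '' toSphere rightHalfPlane = toSphere halfStrip) (z : ℂ) :
    F z ∈ insert OnePoint.infty (toSphere halfStripBoundary) ↔ z.re = 0 := by
  rw [← frontier_toSphere_halfStrip, ← hF, ← F.image_frontier, F.injective.mem_set_image,
    frontier_toSphere_rightHalfPlane]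
  simp [toSphere]

/-- The reflected path has an image which avoids `∞` and `halfStrip`. -/
theorem apply_axisReflection (hF : F '' toSphere rightHalfPlane = toSphere halfStrip) {z w : ℂ}
    (hw : w ∈ halfStrip ∪ halfStripBoundary) (hzw : F z = w) :
    F (axisReflection z) ≠ OnePoint.infty ∧ F (axisReflection z) ∉ toSphere halfStrip := by
  have hre : 0 ≤ z.re := by
    rcases hw with hw | hw
    · exact ((apply_mem_halfStrip_iff hF z).1 (hzw ▸ coe_mem_toSphere.2 hw)).le
    · exact ((apply_mem_frontier_iff hF z).1 (hzw ▸ Or.inr (coe_mem_toSphere.2 hw))).ge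
  refine ⟨fun h => ?_, fun h => ?_⟩
  -- Since `∞` is a boundary point of the half-strip, a finite preimage of it lies on the axis and
  -- is fixed by the reflection; but `F z` is finite.
  · have h0 := (apply_mem_frontier_iff hF (axisReflection z)).1 (Or.inl h)
    rw [axisReflection_re, neg_eq_zero] at h0
    rw [axisReflection_eq_self h0, hzw] at h
    exact OnePoint.coe_ne_infty w h
  · have h0 := (apply_mem_halfStrip_iff hF (axisReflection z)).1 h
    rw [axisReflection_re] at h0
    linarith

theorem apply_axisReflection_of_mem_boundary
    (hF : F '' toSphere rightHalfPlane = toSphere halfStrip) {z w : ℂ}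
    (hw : w ∈ halfStripBoundary) (hzw : F z = w) : F (axisReflection z) = w := by
  rw [axisReflection_eq_self, hzw]
  exact (apply_mem_frontier_iff hF z).1 (hzw ▸ Or.inr (coe_mem_toSphere.2 hw))

/-- A path outside `halfStrip` which connects opposite boundary points at abscissa `x` travels
at least the distance `x - 1`. -/
theorem exists_dist_ge {x b : ℝ} (hb : 0 ≤ b) {c : PlanePath} (h0 : c 0 = verticalSegment x b 0)
    (h1 : c 1 = verticalSegment x b 1) (hc : ∀ t, c t ∉ halfStrip) :
    ∃ t, x - 1 ≤ dist (c t) (c 0) := by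
  have h0' : c 0 = ⟨x, -b⟩ := h0.trans (verticalSegment_zero x b)
  have h1' : c 1 = ⟨x, b⟩ := h1.trans (verticalSegment_one x b)
  obtain ⟨t, ht⟩ : (0 : ℝ) ∈ range fun t => (c t).im :=
    mem_range_of_exists_le_of_exists_ge (Complex.continuous_im.comp c.continuous)
      ⟨0, by simp [h0', hb]⟩ ⟨1, by simp [h1', hb]⟩
  refine ⟨t, ?_⟩
  -- The path crosses the real axis at `t`, and real points beyond `1` belong to the half-strip
  -- because `sinh u ≥ u`.
  have hre : (c t).re ≤ 1 := by
    by_contra! hlt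
    refine hc t ⟨by simp [show (c t).im = 0 from ht, Real.pi_pos], ?_⟩
    rw [show (c t).im = 0 from ht, Real.cos_zero, mul_one]
    linarith [Real.self_le_sinh_iff.2 (zero_le_one.trans hlt.le)]
  have h2 := (neg_le_abs _).trans (Complex.abs_re_le_norm (c t - c 0))
  rw [dist_eq_norm]
  refine le_trans ?_ h2
  rw [Complex.sub_re, h0']
  simp only
  linarith

theorem ofReal_le_of_quasiconformal (hF : F '' toSphere rightHalfPlane = toSphere halfStrip)
    {K : ℝ≥0} (hK : ∀ Γ : Set PlanePath, (∀ c ∈ Γ, ∀ t, F (c t) ≠ OnePoint.infty) →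
      modulus (imageFamily F Γ) ≤ K * modulus Γ ∧ modulus Γ ≤ K * modulus (imageFamily F Γ))
    {R : ℝ} (hR : 2 ≤ R) (hinf : ∀ w : ℂ, F OnePoint.infty = w → w.re < R) :
    ENNReal.ofReal R / 4 ≤ K * (K * ENNReal.ofReal (49 * Real.pi)) := by
  set seg : ℝ → PlanePath := fun x => verticalSegment x (halfWidth x)
  set Γ : Set PlanePath := {d | ∃ x ∈ Icc R (R + R), ∀ t, F (d t) = seg x t}
  have hx2 : ∀ {x}, x ∈ Icc R (R + R) → 2 ≤ x := fun hx => hR.trans hx.1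
  have hΓ : ∀ d ∈ Γ, ∀ t, F (d t) ≠ OnePoint.infty := by
    rintro d ⟨x, -, hd⟩ t
    rw [hd t]
    exact OnePoint.coe_ne_infty _
  have hσΓ : ∀ d ∈ isometryPath axisReflection '' Γ, ∀ t, F (d t) ≠ OnePoint.infty := by
    rintro _ ⟨d, ⟨x, hx, hd⟩, rfl⟩ t
    exact (apply_axisReflection hF (verticalSegment_mem (hx2 hx) t) (hd t)).1
  have hsub : seg '' Icc R (R + R) ⊆ imageFamily F Γ := by
    rintro _ ⟨x, hx, rfl⟩
    -- The cross-cuts lie at abscissas at least `R`, beyond `F ∞`, so their preimages avoid `∞` and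
    -- are plane paths.
    obtain ⟨d, hd⟩ := exists_planePath (G := fun t => F.symm (seg x t))
      (F.symm.continuous.comp (OnePoint.continuous_coe.comp (seg x).continuous)) fun t ht => by
        have h := hinf (seg x t) (by rw [← ht, F.apply_symm_apply])
        exact absurd h (not_lt.2 hx.1)
    have hFd : ∀ t, F (d t) = seg x t := fun t => by rw [hd, F.apply_symm_apply]
    exact ⟨d, ⟨x, hx, hFd⟩, fun t => (hFd t).symm⟩
  have hupper : modulus (imageFamily F (isometryPath axisReflection '' Γ)) ≤
      ENNReal.ofReal (49 * Real.pi) := by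
    -- For `R ≤ x ≤ 2 R` and `R ≥ 2`, the start has norm at most `x + 2 ≤ 3 R = 6 (R / 2)`, and the
    -- path travels `x - 1 ≥ R / 2`.
    refine modulus_le_of_dist (r := R / 2) (by linarith) ?_
    rintro e ⟨_, ⟨d, ⟨x, hx, hd⟩, rfl⟩, he⟩
    have hbd := verticalSegment_mem_halfStripBoundary (hx2 hx)
    have he0 : e 0 = seg x 0 := OnePoint.coe_injective
      ((he 0).trans (apply_axisReflection_of_mem_boundary hF hbd.1 (hd 0)))
    have he1 : e 1 = seg x 1 := OnePoint.coe_injective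
      ((he 1).trans (apply_axisReflection_of_mem_boundary hF hbd.2 (hd 1)))
    have hout : ∀ t, e t ∉ halfStrip := fun t ht => by
      refine (apply_axisReflection hF (verticalSegment_mem (hx2 hx) t) (hd t)).2 ?_
      have := coe_mem_toSphere.2 ht
      rwa [he t] at this
    constructor
    · refine (Complex.norm_le_abs_re_add_abs_im _).trans ?_
      have him : |(e 0).im| ≤ 2 := by
        rw [he0]
        linarith [hbd.1.1, Real.pi_lt_four]
      have hre : (e 0).re = x := by rw [he0]; rfl
      rw [hre, abs_of_nonneg (by linarith [hx2 hx])]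
      linarith [hx.2]
    · obtain ⟨t, ht⟩ := exists_dist_ge (halfWidth_nonneg x) he0 he1 hout
      exact ⟨t, by linarith [hx.1]⟩
  calc ENNReal.ofReal R / 4 ≤ modulus (seg '' Icc R (R + R)) :=
        le_modulus_verticalSegment halfWidth fun x hx => ⟨halfWidth_nonneg x, by
          linarith [halfWidth_lt (hx2 hx), Real.pi_lt_four]⟩
    _ ≤ modulus (imageFamily F Γ) := modulus_mono hsub
    _ ≤ K * modulus Γ := (hK Γ hΓ).1
    _ ≤ K * modulus (isometryPath axisReflection '' Γ) := by
      gcongr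
      exact modulus_le_modulus_isometry _ _
    _ ≤ K * (K * modulus (imageFamily F (isometryPath axisReflection '' Γ))) := by
      gcongr
      exact (hK _ hσΓ).2
    _ ≤ K * (K * ENNReal.ofReal (49 * Real.pi)) := by gcongr

theorem not_isQuasidisk_halfStrip : ¬ IsQuasidisk (toSphere halfStrip) := by
  rintro ⟨F, ⟨K, -, hK⟩, hF⟩
  obtain ⟨a, ha⟩ : ∃ a : ℝ, ∀ w : ℂ, F OnePoint.infty = w → w.re < a := by
    by_cases h : ∃ w : ℂ, F OnePoint.infty = w
    · obtain ⟨w, hw⟩ := h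
      refine ⟨w.re + 1, fun w' hw' => ?_⟩
      rw [OnePoint.coe_injective (hw'.symm.trans hw)]
      linarith
    · exact ⟨0, fun w hw => absurd ⟨w, hw⟩ h⟩
  set M : ℝ := K * (K * (49 * Real.pi))
  have hM : 0 ≤ M := by positivity
  -- The last entry makes `R / 4 > M`, the contradiction; the others ensure `R ≥ 2` and put the
  -- cross-cuts beyond `F ∞`.
  set R : ℝ := max (max 2 a) (4 * M + 1)
  have hle := ofReal_le_of_quasiconformal hF hK (R := R)
    ((le_max_left _ _).trans (le_max_left _ _))
    fun w hw => (ha w hw).trans_le ((le_max_right _ _).trans (le_max_left _ _))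
  have hR : 4 * M + 1 ≤ R := le_max_right _ _
  have hK' : (K : ℝ≥0∞) * (K * ENNReal.ofReal (49 * Real.pi)) = ENNReal.ofReal M := by
    rw [ENNReal.ofReal_mul K.coe_nonneg, ENNReal.ofReal_mul K.coe_nonneg,
      ENNReal.ofReal_coe_nnreal]
  have h4 : ENNReal.ofReal R / 4 = ENNReal.ofReal (R / 4) := by
    rw [ENNReal.ofReal_div_of_pos (by norm_num)]
    norm_num
  rw [hK', h4, ENNReal.ofReal_le_ofReal_iff hM] at hle
  linarith

end NotQuasidisk

end HalfPlaneExample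

theorem corollary3p3 :
    ∃ f : ℂ → ℂ,
      (∀ z ∈ HalfPlaneExample.rightHalfPlane,
        f z = -Complex.I * HalfPlaneExample.arcsin (Complex.I * (z + 1) / 2)) ∧
      HalfPlaneExample.IsConformalMapOn f HalfPlaneExample.rightHalfPlane ∧
      Tendsto f (Bornology.cobounded ℂ ⊓ 𝓟 HalfPlaneExample.rightHalfPlane)
        (Bornology.cobounded ℂ) ∧
      HalfPlaneExample.IsJordanDomain
        (HalfPlaneExample.toSphere (f '' HalfPlaneExample.rightHalfPlane)) ∧
      ¬ HalfPlaneExample.IsQuasidisk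
        (HalfPlaneExample.toSphere (f '' HalfPlaneExample.rightHalfPlane)) ∧
      Tendsto (fun z : ℂ => (2 * z.re) ^ 2 * ‖HalfPlaneExample.schwarzian f z‖)
        (comap Complex.re (𝓝[>] 0)) (𝓝 0) := by
  refine ⟨HalfPlaneExample.halfStripMap, fun z _ => rfl,
    HalfPlaneExample.isConformalMapOn_halfStripMap,
    HalfPlaneExample.tendsto_halfStripMap.mono_left
      (inf_le_inf_left _ (principal_mono.2 HalfPlaneExample.rightHalfPlane_subset)), ?_, ?_,
    HalfPlaneExample.tendsto_schwarzian_halfStripMap⟩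
  · rw [HalfPlaneExample.image_halfStripMap_rightHalfPlane]
    exact HalfPlaneExample.isJordanDomain_halfStrip
  · rw [HalfPlaneExample.image_halfStripMap_rightHalfPlane]
    exact HalfPlaneExample.not_isQuasidisk_halfStrip
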